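/- Let $G$ be a group. For subsets $A,B\subseteq G$ the product $AB$ is called direct if every element of $AB$ can be written in exactly one way as $ab$ with $a\in A$ and $b\in B$. A right subfactor of $G$ related to $A$ is an inclusion-maximal subset $B\subseteq G$ such that $AB$ is direct; a left subfactor of $G$ related to $A$ is an inclusion-maximal subset $B\subseteq G$ such that $BA$ is direct. The right upper and lower indices $|G:A|^+$ and $|G:A|^-$ of $A$ are the supremum and the infimum of the cardinal numbers $|B|$ over all right subfactors $B$ related to $A$; the left upper and lower indices $|G:A|_+$ and $|G:A|_-$ are the supremum and the infimum of $|B|$ over all left subfactors $B$ related to $A$. The subset $A$ is right index stable if $|G:A|^+=|G:A|^-$, left index stable if $|G:A|_+=|G:A|_-$, and (two-sided) index stable if all four of these cardinals are equal. The group $G$ is right, left, or two-sided index stable if all its subsets are. Theorem. Let $G$ be an infinite group. Then: 1. There is a subset $A\subseteq G$ with $|G:A|_-<|G:A|_+=\aleph_0$. 2. There is a subset $A\subseteq G$ with $|G:A|^-<|G:A|^+=\aleph_0$. 3. $G$ is not left index stable, not right index stable, and not two-sided index stable. 4. It is not the case that for every subset $A\subseteq G$ all the inclusion-maximal subsets $B\subseteq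 G$ for which the product $AB$ is direct have the same cardinality. (As $G$ is an arbitrary infinite group, this answers Kourovka Notebook question 21.58 in the negative.) -/

import Mathlib

universe u

namespace GroupSubset

variable {G : Type u} [Group G]

/-- The product `AB` of two subsets of a group is direct: each of its elements has a unique
representation `a * b` with `a ∈ A` and `b ∈ B`. -/
def IsDirect (A B : Set G) : Prop :=
  Set.InjOn (fun p : G × G => p.1 * p.2) (A ×ˢ B)

/-- `B` is a right subfactor of `G` related to `A`: an inclusion-maximal subset of `G` such that
the product `AB` is direct. -/
def IsRightSubfactor (A B : Set G) : Prop :=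
  Maximal (fun X : Set G => IsDirect A X) B

/-- `B` is a left subfactor of `G` related to `A`: an inclusion-maximal subset of `G` such that
the product `BA` is direct. -/
def IsLeftSubfactor (A B : Set G) : Prop :=
  Maximal (fun X : Set G => IsDirect X A) B

/-- The cardinalities of the right subfactors related to `A`. -/
def rightSubfactorCards (A : Set G) : Set Cardinal.{u} :=
  {c | ∃ B : Set G, IsRightSubfactor A B ∧ Cardinal.mk B = c}

/-- The cardinalities of the left subfactors related to `A`. -/
def leftSubfactorCards (A : Set G) : Set Cardinal.{u} :=
  {c | ∃ B : Set G, IsLeftSubfactor A B ∧ Cardinal.mk B = c}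

/-- The right upper index `|G:A|^+`. -/
noncomputable def rightUpperIndex (A : Set G) : Cardinal.{u} := sSup (rightSubfactorCards A)

/-- The right lower index `|G:A|^-`. -/
noncomputable def rightLowerIndex (A : Set G) : Cardinal.{u} := sInf (rightSubfactorCards A)

/-- The left upper index `|G:A|_+`. -/
noncomputable def leftUpperIndex (A : Set G) : Cardinal.{u} := sSup (leftSubfactorCards A)

/-- The left lower index `|G:A|_-`. -/
noncomputable def leftLowerIndex (A : Set G) : Cardinal.{u} := sInf (leftSubfactorCards A)

/-- The subset `A` is right index stable in `G`. -/
def IsRightIndexStable (A : Set G) : Prop := rightUpperIndex A = rightLowerIndex A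

/-- The subset `A` is left index stable in `G`. -/
def IsLeftIndexStable (A : Set G) : Prop := leftUpperIndex A = leftLowerIndex A

/-- The subset `A` is (two-sided) index stable in `G`: its four subindices are equal. -/
def IsIndexStable (A : Set G) : Prop :=
  rightUpperIndex A = rightLowerIndex A ∧ leftUpperIndex A = leftLowerIndex A ∧
    rightUpperIndex A = leftUpperIndex A

/-! The supremum and the infimum above are taken over nonempty sets of cardinals that are bounded
above, so they are not default values. -/

theorem bddAbove_rightSubfactorCards (A : Set G) : BddAbove (rightSubfactorCards A) := by
  refine ⟨Cardinal.mk G, ?_⟩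
  rintro c ⟨B, -, rfl⟩
  exact Cardinal.mk_set_le B

theorem bddAbove_leftSubfactorCards (A : Set G) : BddAbove (leftSubfactorCards A) := by
  refine ⟨Cardinal.mk G, ?_⟩
  rintro c ⟨B, -, rfl⟩
  exact Cardinal.mk_set_le B

theorem rightSubfactorCards_nonempty (A : Set G) : (rightSubfactorCards A).Nonempty := by
  obtain ⟨B, hB⟩ := zorn_subset {X : Set G | IsDirect A X} (by
    intro c hc hchain
    refine ⟨⋃₀ c, ?_, fun s hs => Set.subset_sUnion_of_mem hs⟩
    rintro ⟨a, b⟩ ⟨ha, X, hX, hb⟩ ⟨a', b'⟩ ⟨ha', Y, hY, hb'⟩ h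
    rcases hchain.total hX hY with hXY | hYX
    · exact hc hY ⟨ha, hXY hb⟩ ⟨ha', hb'⟩ h
    · exact hc hX ⟨ha, hb⟩ ⟨ha', hYX hb'⟩ h)
  exact ⟨_, B, hB, rfl⟩

theorem leftSubfactorCards_nonempty (A : Set G) : (leftSubfactorCards A).Nonempty := by
  obtain ⟨B, hB⟩ := zorn_subset {X : Set G | IsDirect X A} (by
    intro c hc hchain
    refine ⟨⋃₀ c, ?_, fun s hs => Set.subset_sUnion_of_mem hs⟩
    rintro ⟨a, b⟩ ⟨⟨X, hX, ha⟩, hb⟩ ⟨a', b'⟩ ⟨⟨Y, hY, ha'⟩, hb'⟩ h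
    rcases hchain.total hX hY with hXY | hYX
    · exact hc hY ⟨hXY ha, hb⟩ ⟨ha', hb'⟩ h
    · exact hc hX ⟨ha, hb⟩ ⟨hYX ha', hb'⟩ h)
  exact ⟨_, B, hB, rfl⟩

end GroupSubset

/-- The group `G` is right index stable: all its subsets are. -/
def IsRightIndexStableGroup (G : Type u) [Group G] : Prop :=
  ∀ A : Set G, GroupSubset.IsRightIndexStable A

/-- The group `G` is left index stable: all its subsets are. -/
def IsLeftIndexStableGroup (G : Type u) [Group G] : Prop :=
  ∀ A : Set G, GroupSubset.IsLeftIndexStable A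

/-- The group `G` is (two-sided) index stable: all its subsets are. -/
def IsIndexStableGroup (G : Type u) [Group G] : Prop :=
  ∀ A : Set G, GroupSubset.IsIndexStable A

namespace GroupSubset

/-! ### Generic finite sets, with "almost all" meant along a nonprincipal ultrafilter. -/

section Generic

open Filter

/-! Let T be the complement of A⁻¹A. Then AB is direct exactly when b * c⁻¹ ∈ T for all distinct b,
c ∈ B, so right subfactors are the maximal cliques of the Cayley graph with connection set T
(`isDirect_iff_of_compl`). It suffices to find a graph with both finite and infinite maximal cliques
whose T is such a complement.

Take T to consist of t, t⁻¹ and the nontrivial quotients of an infinite countable set X. Then X is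
an infinite clique, and all cliques are countable because T is. If t is not a product of two
nontrivial quotients of X, every clique containing 1 and t lies in {1, t, t⁻¹, t * t}, hence is
finite.

Such t and X are built by adding one generic element at a time (`exists_infinite_generic`). A set A
realizing T comes from a transfinite recursion (`exists_quotient_set_compl`), which needs T to be
small enough that its translates by fewer than #G elements leave room. Inversion carries the result
to left subfactors. -/

theorem eventually_hyperfilter_ne {α : Type*} [Infinite α] (g : α) : ∀ᶠ x in (hyperfilter α : Filter α), x ≠ g :=
  (Set.finite_singleton g).compl_mem_hyperfilter

/-- In an ultrafilter, failing to hold almost always means almost always failing. Two bad values of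
x would therefore share some y at which both fail, so at most one x is bad. -/
theorem eventually_eventually_hyperfilter {α : Type*} [Infinite α] {P : α → α → Prop}
    (h : ∀ x x' y, ¬ P x y → ¬ P x' y → x = x') :
    ∀ᶠ x in (hyperfilter α : Filter α), ∀ᶠ y in (hyperfilter α : Filter α), P x y := by
  have hs : {x | ¬ ∀ᶠ y in (hyperfilter α : Filter α), P x y}.Subsingleton := by
    intro x hx x' hx'
    rw [Set.mem_ofPred_eq, ← Ultrafilter.eventually_not] at hx hx'
    obtain ⟨y, hy, hy'⟩ := (hx.and hx').exists
    exact h x x' y hy hy'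
  filter_upwards [hs.finite.compl_mem_hyperfilter] with x hx
  simpa using hx

variable {G : Type u} [Group G] [Infinite G]

/-- A finite set `X` such that `t` is not a product of two nontrivial quotients of elements
of `X`, and such that this remains so when `X` is enlarged by almost any element. -/
structure IsGeneric (t : G) (X : Finset G) : Prop where
  quad : ∀ a ∈ X, ∀ b ∈ X, ∀ c ∈ X, ∀ d ∈ X, a ≠ b → c ≠ d → a * b⁻¹ * (c * d⁻¹) ≠ t
  pair : ∀ a ∈ X, ∀ d ∈ X, a * d⁻¹ ≠ t
  conj : ∀ b ∈ X, ∀ c ∈ X, ∀ᶠ x in (hyperfilter G : Filter G), x * b⁻¹ * (c * x⁻¹) ≠ t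
  sq : ∀ b ∈ X, ∀ d ∈ X, ∀ᶠ x in (hyperfilter G : Filter G), x * b⁻¹ * (x * d⁻¹) ≠ t
  sqInv : ∀ a ∈ X, ∀ c ∈ X, ∀ᶠ x in (hyperfilter G : Filter G), a * x⁻¹ * (c * x⁻¹) ≠ t

theorem IsGeneric.empty (t : G) : IsGeneric t ∅ := by constructor <;> simp

theorem exists_generic_base : ∃ t : G, t ≠ 1 ∧
    (∀ᶠ x in (hyperfilter G : Filter G), ∀ᶠ y in (hyperfilter G : Filter G),
      y * x⁻¹ * (y * x⁻¹) ≠ t) ∧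
    (∀ᶠ x in (hyperfilter G : Filter G), ∀ᶠ y in (hyperfilter G : Filter G),
      x * y⁻¹ * (x * y⁻¹) ≠ t) := by
  have key : ∀ w : G → G → G, {t : G | ¬ ∀ᶠ x in (hyperfilter G : Filter G),
      ∀ᶠ y in (hyperfilter G : Filter G), w x y ≠ t}.Subsingleton := by
    intro w s hs t ht
    -- Along an ultrafilter a bad t is the value of w x y for almost all x and y, so each word has
    -- at most one bad t.
    simp only [Set.mem_ofPred_eq, ← Ultrafilter.eventually_not, not_not] at hs ht
    obtain ⟨x, hx, hx'⟩ := (hs.and ht).exists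
    obtain ⟨y, hy, hy'⟩ := (hx.and hx').exists
    exact hy.symm.trans hy'
  obtain ⟨t, ht⟩ := ((Set.finite_singleton (1 : G)).union
    ((key fun x y => y * x⁻¹ * (y * x⁻¹)).finite.union
      (key fun x y => x * y⁻¹ * (x * y⁻¹)).finite)).exists_notMem
  simp only [Set.mem_union, Set.mem_singleton_iff, Set.mem_ofPred_eq, not_or, not_not] at ht
  exact ⟨t, ht⟩

/-- A word in which the new x occurs once takes the value t for at most one x. Where x occurs twice,
the equation may hold for many x, and the fields `conj`, `sq`, `sqInv` exclude this in advance; when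
the two occurrences cancel, `pair` applies. These fields persist because, with one parameter fixed,
at most one new value of the other is bad. If both parameters are the new element, `ht`, `h₁` and
`h₂` are what is needed. -/
theorem IsGeneric.eventually_insert [DecidableEq G] {t : G} {X : Finset G} (hX : IsGeneric t X)
    (ht : t ≠ 1)
    (h₁ : ∀ᶠ x in (hyperfilter G : Filter G), ∀ᶠ y in (hyperfilter G : Filter G),
      y * x⁻¹ * (y * x⁻¹) ≠ t)
    (h₂ : ∀ᶠ x in (hyperfilter G : Filter G), ∀ᶠ y in (hyperfilter G : Filter G),
      x * y⁻¹ * (x * y⁻¹) ≠ t) :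
    ∀ᶠ x in (hyperfilter G : Filter G), IsGeneric t (insert x X) := by
  have all₂ : ∀ {P : G → G → G → Prop},
      (∀ a ∈ X, ∀ b ∈ X, ∀ᶠ x in (hyperfilter G : Filter G), P a b x) →
      ∀ᶠ x in (hyperfilter G : Filter G), ∀ a ∈ X, ∀ b ∈ X, P a b x := by
    intro P h
    rw [eventually_all_finset]
    intro a ha
    rw [eventually_all_finset]
    exact h a ha
  have all₃ : ∀ {P : G → G → G → G → Prop},
      (∀ a b c, ∀ᶠ x in (hyperfilter G : Filter G), P a b c x) →
      ∀ᶠ x in (hyperfilter G : Filter G), ∀ a ∈ X, ∀ b ∈ X, ∀ c ∈ X, P a b c x := by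
    intro P h
    refine all₂ fun a _ b _ => ?_
    rw [eventually_all_finset]
    exact fun c _ => h a b c
  have ne : ∀ {P : G → Prop} (g : G), (∀ x, x ≠ g → P x) →
      ∀ᶠ x in (hyperfilter G : Filter G), P x :=
    fun g h => (eventually_hyperfilter_ne g).mono h
  have q₁ := all₃ fun b c d => ne (P := fun x => x * b⁻¹ * (c * d⁻¹) ≠ t)
    (t * (b⁻¹ * (c * d⁻¹))⁻¹) (by rintro x hx rfl; exact hx (by group))
  have q₂ := all₃ fun a c d => ne (P := fun x => a * x⁻¹ * (c * d⁻¹) ≠ t)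
    (c * d⁻¹ * t⁻¹ * a) (by rintro x hx rfl; exact hx (by group))
  have q₃ := all₃ fun a b d => ne (P := fun x => a * b⁻¹ * (x * d⁻¹) ≠ t)
    (b * a⁻¹ * t * d) (by rintro x hx rfl; exact hx (by group))
  have q₄ := all₃ fun a b c => ne (P := fun x => a * b⁻¹ * (c * x⁻¹) ≠ t)
    (t⁻¹ * a * b⁻¹ * c) (by rintro x hx rfl; exact hx (by group))
  have p₁ := all₂ fun d _ _ _ => ne (P := fun x => x * d⁻¹ ≠ t)
    (t * d) (by rintro x hx rfl; exact hx (by group))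
  have p₂ := all₂ fun a _ _ _ => ne (P := fun x => a * x⁻¹ ≠ t)
    (t⁻¹ * a) (by rintro x hx rfl; exact hx (by group))
  have c₁ := all₂ fun b _ _ _ => eventually_eventually_hyperfilter
    (P := fun x y => y * b⁻¹ * (x * y⁻¹) ≠ t) (by
      intro x x' y h h'
      rw [not_not] at h h'
      simpa using h.trans h'.symm)
  have c₂ := all₂ fun c _ _ _ => eventually_eventually_hyperfilter
    (P := fun x y => y * x⁻¹ * (c * y⁻¹) ≠ t) (by
      intro x x' y h h'
      rw [not_not] at h h'
      simpa using h.trans h'.symm)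
  have s₁ := all₂ fun d _ _ _ => eventually_eventually_hyperfilter
    (P := fun x y => y * x⁻¹ * (y * d⁻¹) ≠ t) (by
      intro x x' y h h'
      rw [not_not] at h h'
      simpa using h.trans h'.symm)
  have s₂ := all₂ fun b _ _ _ => eventually_eventually_hyperfilter
    (P := fun x y => y * b⁻¹ * (y * x⁻¹) ≠ t) (by
      intro x x' y h h'
      rw [not_not] at h h'
      simpa using h.trans h'.symm)
  have r₁ := all₂ fun c _ _ _ => eventually_eventually_hyperfilter
    (P := fun x y => x * y⁻¹ * (c * y⁻¹) ≠ t) (by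
      intro x x' y h h'
      rw [not_not] at h h'
      simpa using h.trans h'.symm)
  have r₂ := all₂ fun a _ _ _ => eventually_eventually_hyperfilter
    (P := fun x y => a * y⁻¹ * (x * y⁻¹) ≠ t) (by
      intro x x' y h h'
      rw [not_not] at h h'
      simpa using h.trans h'.symm)
  filter_upwards [q₁, q₂, q₃, q₄, p₁, p₂, c₁, c₂, s₁, s₂, r₁, r₂, h₁, h₂, all₂ hX.conj,
    all₂ hX.sq, all₂ hX.sqInv] with x q₁ q₂ q₃ q₄ p₁ p₂ c₁ c₂ s₁ s₂ r₁ r₂ h₁ h₂ c₀ s₀ r₀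
  constructor
  · simp only [Finset.mem_insert]
    rintro a (rfl | ha) b (rfl | hb) c (rfl | hc) d (rfl | hd) hab hcd
    all_goals try exact absurd rfl hab
    all_goals try exact absurd rfl hcd
    · exact s₀ b hb d hd
    · exact c₀ b hb c hc
    · exact q₁ b hb c hc d hd
    · simpa using hX.pair a ha d hd
    · exact r₀ a ha c hc
    · exact q₂ a ha c hc d hd
    · exact q₃ a ha b hb d hd
    · exact q₄ a ha b hb c hc
    · exact hX.quad a ha b hb c hc d hd hab hcd
  · simp only [Finset.mem_insert]
    rintro a (rfl | ha) d (rfl | hd)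
    · simpa using ht.symm
    · exact p₁ d hd d hd
    · exact p₂ a ha a ha
    · exact hX.pair a ha d hd
  · simp only [Finset.mem_insert]
    rintro b (rfl | hb) c (rfl | hc)
    · simpa using ht.symm
    · exact c₂ c hc c hc
    · exact c₁ b hb b hb
    · exact hX.conj b hb c hc
  · simp only [Finset.mem_insert]
    rintro b (rfl | hb) d (rfl | hd)
    · exact h₁
    · exact s₁ d hd d hd
    · exact s₂ b hb b hb
    · exact hX.sq b hb d hd
  · simp only [Finset.mem_insert]
    rintro a (rfl | ha) c (rfl | hc)
    · exact h₂
    · exact r₁ c hc c hc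
    · exact r₂ a ha a ha
    · exact hX.sqInv a ha c hc

end Generic

/-! ### The connection set T and the construction of t and X. -/

section Connection

variable {G : Type u} [Group G]

open Filter

/-- The nontrivial quotients of elements of `X` together with `t` and `t⁻¹`. -/
def connectionSet (t : G) (X : Set G) : Set G :=
  {s | s = t ∨ s = t⁻¹ ∨ ∃ a ∈ X, ∃ b ∈ X, a ≠ b ∧ a * b⁻¹ = s}

theorem inv_mem_connectionSet {t : G} {X : Set G} {s : G} (hs : s ∈ connectionSet t X) :
    s⁻¹ ∈ connectionSet t X := by
  rcases hs with rfl | rfl | ⟨a, ha, b, hb, hab, rfl⟩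
  · exact Or.inr (Or.inl rfl)
  · exact Or.inl (inv_inv t)
  · exact Or.inr (Or.inr ⟨b, hb, a, ha, hab.symm, by simp⟩)

theorem one_notMem_connectionSet {t : G} (ht : t ≠ 1) (X : Set G) : 1 ∉ connectionSet t X := by
  rintro (h | h | ⟨a, -, b, -, hab, h⟩)
  · exact ht h.symm
  · exact ht (inv_eq_one.1 h.symm)
  · exact hab (mul_inv_eq_one.1 h)

theorem countable_connectionSet (t : G) {X : Set G} (hX : X.Countable) :
    (connectionSet t X).Countable := by
  refine (((Set.countable_singleton t).union (Set.countable_singleton t⁻¹)).union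
    (hX.image2 hX fun a b => a * b⁻¹)).mono ?_
  rintro s (rfl | rfl | ⟨a, ha, b, hb, -, rfl⟩)
  · simp
  · simp
  · exact Or.inr ⟨a, ha, b, hb, rfl⟩

theorem finite_connectionSet (t : G) {X : Set G} (hX : X.Finite) :
    (connectionSet t X).Finite := by
  refine (((Set.finite_singleton t).union (Set.finite_singleton t⁻¹)).union
    (hX.image2 (fun a b => a * b⁻¹) hX)).subset ?_
  rintro s (rfl | rfl | ⟨a, ha, b, hb, -, rfl⟩)
  · simp
  · simp
  · exact Or.inr ⟨a, ha, b, hb, rfl⟩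

variable [Infinite G]

/-- W records elements promised to stay outside T forever. As T is still finite, some w avoids E * T
* E, so all a⁻¹ * w * g⁻¹ can be added to W; almost every x then enlarges X without its new
quotients meeting W. -/
theorem exists_generic_extension {t : G} (ht : t ≠ 1)
    (h₁ : ∀ᶠ x in (hyperfilter G : Filter G), ∀ᶠ y in (hyperfilter G : Filter G),
      y * x⁻¹ * (y * x⁻¹) ≠ t)
    (h₂ : ∀ᶠ x in (hyperfilter G : Filter G), ∀ᶠ y in (hyperfilter G : Filter G),
      x * y⁻¹ * (x * y⁻¹) ≠ t) (E X W : Finset G) (hX : IsGeneric t X)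
    (hW : Disjoint (W : Set G) (connectionSet t X)) :
    ∃ X' W' : Finset G, IsGeneric t X' ∧ Disjoint (W' : Set G) (connectionSet t X') ∧
      X ⊂ X' ∧ W ⊆ W' ∧ ∃ w, ∀ a ∈ E, ∀ g ∈ E, a⁻¹ * w * g⁻¹ ∈ W' := by
  classical
  obtain ⟨w, hw⟩ := ((E.finite_toSet.image2 (· * ·)
    (finite_connectionSet t X.finite_toSet)).image2 (· * ·) E.finite_toSet).exists_notMem
  have hw' : ∀ a ∈ E, ∀ g ∈ E, a⁻¹ * w * g⁻¹ ∉ connectionSet t (X : Set G) := by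
    intro a ha g hg h
    exact hw ⟨_, ⟨a, ha, _, h, rfl⟩, g, hg, by group⟩
  set W' : Finset G := W ∪ Finset.image₂ (fun a g => a⁻¹ * w * g⁻¹) E E
  have hW' : Disjoint (W' : Set G) (connectionSet t X) := by
    rw [Set.disjoint_left] at hW ⊢
    intro v hv
    rcases Finset.mem_union.1 hv with hv | hv
    · exact hW hv
    · obtain ⟨a, ha, g, hg, rfl⟩ := Finset.mem_image₂.1 hv
      exact hw' a ha g hg
  have ev : ∀ᶠ x in (hyperfilter G : Filter G), ∀ v ∈ W', ∀ b ∈ X, x * b⁻¹ ≠ v ∧ b * x⁻¹ ≠ v := by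
    rw [eventually_all_finset]
    intro v _
    rw [eventually_all_finset]
    intro b _
    filter_upwards [eventually_hyperfilter_ne (v * b), eventually_hyperfilter_ne (v⁻¹ * b)]
      with x hx hx'
    exact ⟨by rintro rfl; simp at hx, by rintro rfl; simp at hx'⟩
  have ev' : ∀ᶠ x in (hyperfilter G : Filter G), x ∉ X :=
    X.finite_toSet.compl_mem_hyperfilter
  obtain ⟨x, hx, hxW, hxX⟩ := ((hX.eventually_insert ht h₁ h₂).and (ev.and ev')).exists
  refine ⟨insert x X, W', hx, ?_, Finset.ssubset_insert hxX, Finset.subset_union_left, w, ?_⟩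
  · rw [Set.disjoint_left] at hW' ⊢
    rintro v hv (h | h | ⟨a, ha, b, hb, hab, h⟩)
    · exact hW' hv (Or.inl h)
    · exact hW' hv (Or.inr (Or.inl h))
    · rcases Finset.mem_insert.1 ha with hax | ha <;> rcases Finset.mem_insert.1 hb with hbx | hb
      · exact hab (hax.trans hbx.symm)
      · exact (hxW v hv b hb).1 (hax ▸ h)
      · exact (hxW v hv a ha).2 (hbx ▸ h)
      · exact hW' hv (Or.inr (Or.inr ⟨a, ha, b, hb, hab, h⟩))
  · intro a ha g hg
    exact Finset.mem_union_right _ (Finset.mem_image₂_of_mem ha hg)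

theorem exists_infinite_generic (e : ℕ → Finset G) : ∃ t : G, t ≠ 1 ∧ ∃ X : Set G, X.Infinite ∧
    X.Countable ∧
    (∀ a ∈ X, ∀ b ∈ X, ∀ c ∈ X, ∀ d ∈ X, a ≠ b → c ≠ d → a * b⁻¹ * (c * d⁻¹) ≠ t) ∧
    ∀ n, ∃ w, ∀ a ∈ e n, ∀ g ∈ e n, a⁻¹ * w * g⁻¹ ∉ connectionSet t X := by
  obtain ⟨t, ht, h₁, h₂⟩ := exists_generic_base (G := G)
  let S := {p : Finset G × Finset G // IsGeneric t p.1 ∧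
    Disjoint (p.2 : Set G) (connectionSet t p.1)}
  have step : ∀ (n : ℕ) (p : S), ∃ q : S, p.1.1 ⊂ q.1.1 ∧ p.1.2 ⊆ q.1.2 ∧
      ∃ w, ∀ a ∈ e n, ∀ g ∈ e n, a⁻¹ * w * g⁻¹ ∈ q.1.2 := by
    rintro n ⟨⟨X, W⟩, hX, hW⟩
    obtain ⟨X', W', hX', hW', h⟩ := exists_generic_extension ht h₁ h₂ (e n) X W hX hW
    exact ⟨⟨⟨X', W'⟩, hX', hW'⟩, h⟩
  choose next hnext using step
  let s : ℕ → S := fun n => Nat.rec ⟨⟨∅, ∅⟩, IsGeneric.empty t, by simp⟩ next n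
  have hs : ∀ n, s (n + 1) = next n (s n) := fun _ => rfl
  have hX : StrictMono fun n => (s n).1.1 :=
    strictMono_nat_of_lt_succ fun n => by rw [hs]; exact (hnext n (s n)).1
  have hW : Monotone fun n => (s n).1.2 :=
    monotone_nat_of_le_succ fun n => by rw [hs]; exact (hnext n (s n)).2.1
  have hsub : ∀ {m n : ℕ} {a : G}, m ≤ n → a ∈ (s m).1.1 → a ∈ (s n).1.1 :=
    fun h ha => hX.monotone h ha
  refine ⟨t, ht, ⋃ n, ((s n).1.1 : Set G), ?_, ?_, ?_, ?_⟩
  · intro hfin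
    obtain ⟨F, hF⟩ := hfin.exists_finset_coe
    have hle : ∀ n, (s n).1.1 ⊆ F := by
      intro n a ha
      rw [← Finset.mem_coe, hF]
      exact Set.mem_iUnion.2 ⟨n, ha⟩
    have hinj : Set.Finite (Set.range fun n => (s n).1.1) :=
      (F.powerset.finite_toSet).subset (by
        rintro _ ⟨n, rfl⟩
        exact Finset.mem_coe.2 (Finset.mem_powerset.2 (hle n)))
    exact Set.infinite_range_of_injective hX.injective hinj
  · exact Set.countable_iUnion fun n => (s n).1.1.countable_toSet
  · simp only [Set.mem_iUnion, Finset.mem_coe]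
    rintro a ⟨i, ha⟩ b ⟨j, hb⟩ c ⟨k, hc⟩ d ⟨l, hd⟩
    exact (s (max (max i j) (max k l))).2.1.quad a (hsub (by simp) ha) b (hsub (by simp) hb)
      c (hsub (by simp) hc) d (hsub (by simp) hd)
  · intro n
    obtain ⟨w, hw⟩ := (hnext n (s n)).2.2
    refine ⟨w, fun a ha g hg h => ?_⟩
    have hv : a⁻¹ * w * g⁻¹ ∈ (s (n + 1)).1.2 := hw a ha g hg
    rcases h with h | h | ⟨x, hx, y, hy, hxy, h⟩
    · exact Set.disjoint_left.1 (s (n + 1)).2.2 hv (Or.inl h)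
    · exact Set.disjoint_left.1 (s (n + 1)).2.2 hv (Or.inr (Or.inl h))
    · obtain ⟨i, hi⟩ := Set.mem_iUnion.1 hx
      obtain ⟨j, hj⟩ := Set.mem_iUnion.1 hy
      exact Set.disjoint_left.1 (s (max (n + 1) (max i j))).2.2
        (hW (le_max_left _ _) hv)
        (Or.inr (Or.inr ⟨x, hsub (by simp) hi, y, hsub (by simp) hj, hxy, h⟩))

end Connection

/-! ### Realizing T as the complement of a quotient set A⁻¹A. -/

section Realization

variable {G : Type u} [Group G]

open Cardinal

/-- Well-order G in type `(#G).ord` and recursively place a pair f h, f h * h, whose quotient is h,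
so that its quotients with the fewer than #G earlier points avoid T; `cover` provides the room. The
pairs with h ∉ T make up A: they realize every such h, and any quotient within a pair is 1, h or
h⁻¹, none of which is in T. -/
theorem exists_quotient_set_compl [Infinite G] {T : Set G} (hT : ∀ s ∈ T, s⁻¹ ∈ T) (h1 : 1 ∉ T)
    (cover : ∀ S : Set G, #S < #G → ∀ g, ∃ w, ∀ a ∈ S, a⁻¹ * w ∉ T ∧ a⁻¹ * (w * g) ∉ T) :
    ∃ A : Set G, ∀ g, g ∈ T ↔ ¬ ∃ a ∈ A, ∃ b ∈ A, a⁻¹ * b = g := by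
  obtain ⟨r, hr, hord⟩ := Cardinal.exists_ord_eq G
  have hinf : ℵ₀ ≤ #G := Cardinal.infinite_iff.1 inferInstance
  have step : ∀ (h : G) (f : ∀ k, r k h → G), ∃ w, ∀ k (hk : r k h),
      ((f k hk)⁻¹ * w ∉ T ∧ (f k hk)⁻¹ * (w * h) ∉ T) ∧
      ((f k hk * k)⁻¹ * w ∉ T ∧ (f k hk * k)⁻¹ * (w * h) ∉ T) := by
    intro h f
    have hlt : #{k // r k h} < #G := Cardinal.card_typein_lt h hord
    obtain ⟨w, hw⟩ := cover
      (Set.range (fun k : {k // r k h} => f k.1 k.2) ∪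
        Set.range (fun k : {k // r k h} => f k.1 k.2 * k.1))
      ((Cardinal.mk_union_le _ _).trans_lt (Cardinal.add_lt_of_lt hinf
        (Cardinal.mk_range_le.trans_lt hlt) (Cardinal.mk_range_le.trans_lt hlt))) h
    exact ⟨w, fun k hk => ⟨hw _ (Or.inl ⟨⟨k, hk⟩, rfl⟩), hw _ (Or.inr ⟨⟨k, hk⟩, rfl⟩)⟩⟩
  choose next hnext using step
  let f : G → G := IsWellFounded.fix r next
  have hf : ∀ {k h : G}, r k h → ((f k)⁻¹ * f h ∉ T ∧ (f k)⁻¹ * (f h * h) ∉ T) ∧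
      ((f k * k)⁻¹ * f h ∉ T ∧ (f k * k)⁻¹ * (f h * h) ∉ T) := by
    intro k h hk
    have hfh : f h = next h fun k _ => f k := IsWellFounded.fix_eq r next h
    rw [hfh]
    exact hnext h (fun k _ => f k) k hk
  have hlt : ∀ {k h y z : G}, r k h → (y = f k ∨ y = f k * k) → (z = f h ∨ z = f h * h) →
      y⁻¹ * z ∉ T := by
    rintro k h y z hk (rfl | rfl) (rfl | rfl)
    · exact (hf hk).1.1
    · exact (hf hk).1.2
    · exact (hf hk).2.1
    · exact (hf hk).2.2
  refine ⟨{y | ∃ h, h ∉ T ∧ (y = f h ∨ y = f h * h)}, fun g => ⟨?_, fun hg => ?_⟩⟩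
  · rintro hg ⟨y, ⟨k, hkT, hy⟩, z, ⟨h, -, hz⟩, rfl⟩
    rcases trichotomous_of r k h with hkh | rfl | hkh
    · exact hlt hkh hy hz hg
    · rcases hy with rfl | rfl <;> rcases hz with rfl | rfl
      · exact h1 (by simpa using hg)
      · exact hkT (by simpa using hg)
      · exact hkT (by simpa using hT _ hg)
      · exact h1 (by simpa using hg)
    · exact hlt hkh hz hy (by simpa using hT _ hg)
  · by_contra hgT
    exact hg ⟨f g, ⟨g, hgT, Or.inl rfl⟩, f g * g, ⟨g, hgT, Or.inr rfl⟩, by simp⟩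

/-- In the uncountable case counting suffices: the forbidden w form the sets S * T and S * T * g⁻¹,
of cardinality below #G. -/
theorem exists_notMem_translates_of_countable [Uncountable G] {T : Set G} (hT : T.Countable)
    {S : Set G} (hS : #S < #G) (g : G) :
    ∃ w, ∀ a ∈ S, a⁻¹ * w ∉ T ∧ a⁻¹ * (w * g) ∉ T := by
  have hG : ℵ₀ < #G := Cardinal.aleph0_lt_mk_iff.2 inferInstance
  have hlt : #(S × T) < #G := by
    rw [Cardinal.mk_prod, Cardinal.lift_id, Cardinal.lift_id]
    exact Cardinal.mul_lt_of_lt hG.le hS ((Cardinal.le_aleph0_iff_set_countable.2 hT).trans_lt hG)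
  have hU : #(Set.range (fun p : S × T => p.1.1 * p.2.1) ∪
      Set.range (fun p : S × T => p.1.1 * p.2.1 * g⁻¹) : Set G) < #G :=
    (Cardinal.mk_union_le _ _).trans_lt (Cardinal.add_lt_of_lt hG.le
      (Cardinal.mk_range_le.trans_lt hlt) (Cardinal.mk_range_le.trans_lt hlt))
  obtain ⟨w, hw⟩ : ∃ w, w ∉ Set.range (fun p : S × T => p.1.1 * p.2.1) ∪
      Set.range (fun p : S × T => p.1.1 * p.2.1 * g⁻¹) := by
    by_contra! h
    rw [Set.eq_univ_of_forall h, Cardinal.mk_univ] at hU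
    exact hU.false
  refine ⟨w, fun a ha => ⟨fun h => hw (Or.inl ⟨(⟨a, ha⟩, ⟨_, h⟩), ?_⟩),
    fun h => hw (Or.inr ⟨(⟨a, ha⟩, ⟨_, h⟩), ?_⟩)⟩⟩ <;> simp [mul_assoc]

theorem exists_connectionSet_eq_compl [Infinite G] : ∃ t : G, t ≠ 1 ∧ ∃ X : Set G, X.Infinite ∧
    X.Countable ∧
    (∀ a ∈ X, ∀ b ∈ X, ∀ c ∈ X, ∀ d ∈ X, a ≠ b → c ≠ d → a * b⁻¹ * (c * d⁻¹) ≠ t) ∧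
    ∃ A : Set G, ∀ g, g ∈ connectionSet t X ↔ ¬ ∃ a ∈ A, ∃ b ∈ A, a⁻¹ * b = g := by
  classical
  -- Only a countable G needs the enumeration of finite subsets; otherwise `e` is a dummy.
  obtain ⟨e, he⟩ : ∃ e : ℕ → Finset G, Countable G → Function.Surjective e := by
    by_cases hG : Countable G
    · obtain ⟨e, he⟩ := exists_surjective_nat (Finset G)
      exact ⟨e, fun _ => he⟩
    · exact ⟨fun _ => ∅, fun h => absurd h hG⟩
  obtain ⟨t, ht, X, hXi, hXc, hX, hw⟩ := exists_infinite_generic e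
  refine ⟨t, ht, X, hXi, hXc, hX, exists_quotient_set_compl
    (fun s => inv_mem_connectionSet) (one_notMem_connectionSet ht X) fun S hS g => ?_⟩
  by_cases hG : Countable G
  · have hSf : S.Finite :=
      Cardinal.lt_aleph0_iff_set_finite.1 (hS.trans_le Cardinal.mk_le_aleph0)
    -- Right factors 1 and g⁻¹ turn a⁻¹ * w * (·)⁻¹ into a⁻¹ * w and a⁻¹ * w * g.
    obtain ⟨n, hn⟩ := he hG (hSf.toFinset ∪ {1, g⁻¹})
    obtain ⟨w, hw⟩ := hw n
    have mem : ∀ {a}, a ∈ S → a ∈ e n := fun ha => by simp [hn, ha]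
    refine ⟨w, fun a ha => ⟨?_, ?_⟩⟩
    · simpa using hw a (mem ha) 1 (by simp [hn])
    · simpa [mul_assoc] using hw a (mem ha) g⁻¹ (by simp [hn])
  · have : Uncountable G := not_countable_iff.1 hG
    exact exists_notMem_translates_of_countable (countable_connectionSet t hXc) hS g

end Realization

/-! ### Subfactors as maximal cliques, and passage from right to left. -/

section Subfactors

variable {G : Type u} [Group G]

open Cardinal

theorem isDirect_iff_of_compl {A T : Set G}
    (hA : ∀ g, g ∈ T ↔ ¬ ∃ a ∈ A, ∃ b ∈ A, a⁻¹ * b = g) (B : Set G) :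
    IsDirect A B ↔ ∀ b ∈ B, ∀ c ∈ B, b ≠ c → b * c⁻¹ ∈ T := by
  constructor
  · intro h b hb c hc hbc
    rw [hA]
    rintro ⟨x, hx, y, hy, hxy⟩
    refine hbc (congrArg Prod.snd (@h (x, b) ⟨hx, hb⟩ (y, c) ⟨hy, hc⟩ ?_))
    have : y = x * (b * c⁻¹) := by rw [← hxy]; group
    simp [this, mul_assoc]
  · rintro h ⟨x, b⟩ ⟨hx, hb⟩ ⟨y, c⟩ ⟨hy, hc⟩ hxy
    simp only at hx hb hy hc hxy
    by_cases hbc : b = c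
    · subst hbc
      simpa using hxy
    · refine absurd ⟨x, hx, y, hy, ?_⟩ ((hA _).1 (h b hb c hc hbc))
      rw [inv_mul_eq_iff_eq_mul, ← mul_assoc, hxy, mul_inv_cancel_right]

theorem IsDirect.exists_isRightSubfactor {A B : Set G} (hB : IsDirect A B) :
    ∃ C, B ⊆ C ∧ IsRightSubfactor A C := by
  refine zorn_subset_nonempty {X : Set G | IsDirect A X} ?_ B hB
  intro c hc hchain _
  refine ⟨⋃₀ c, ?_, fun s hs => Set.subset_sUnion_of_mem hs⟩
  rintro ⟨a, b⟩ ⟨ha, X, hX, hb⟩ ⟨a', b'⟩ ⟨ha', Y, hY, hb'⟩ h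
  rcases hchain.total hX hY with hXY | hYX
  · exact hc hY ⟨ha, hXY hb⟩ ⟨ha', hb'⟩ h
  · exact hc hX ⟨ha, hb⟩ ⟨ha', hYX hb'⟩ h

/-- Every infinite group has a subset whose right subfactors are all countable, some of them
infinite and some finite. -/
theorem exists_finite_and_infinite_rightSubfactors (G : Type u) [Group G] [Infinite G] :
    ∃ A : Set G, (∀ B, IsRightSubfactor A B → B.Countable) ∧
      (∃ B, IsRightSubfactor A B ∧ B.Infinite) ∧ ∃ B, IsRightSubfactor A B ∧ B.Finite := by
  obtain ⟨t, ht, X, hXi, hXc, hX, A, hA⟩ := exists_connectionSet_eq_compl (G := G)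
  have hdir := isDirect_iff_of_compl hA
  refine ⟨A, fun B hB => ?_, ?_, ?_⟩
  · rcases B.eq_empty_or_nonempty with rfl | ⟨b, hb⟩
    · exact Set.countable_empty
    · refine (((countable_connectionSet t hXc).image (· * b)).insert b).mono fun c hc => ?_
      by_cases hcb : c = b
      · exact Or.inl hcb
      · exact Or.inr ⟨c * b⁻¹, (hdir B).1 hB.prop c hc b hb hcb, by simp⟩
  · obtain ⟨B, hXB, hB⟩ := IsDirect.exists_isRightSubfactor ((hdir X).2
      fun b hb c hc hbc => Or.inr (Or.inr ⟨b, hb, c, hc, hbc, rfl⟩))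
    exact ⟨B, hB, hXi.mono hXB⟩
  -- The finite subfactor extends the edge {1, t}: a further c has both c and c * t⁻¹ in T.
  · obtain ⟨B, htB, hB⟩ := IsDirect.exists_isRightSubfactor ((hdir {1, t}).2 (by
      rintro b (rfl | rfl) c (rfl | rfl) hbc
      · exact absurd rfl hbc
      · exact Or.inr (Or.inl (by simp))
      · exact Or.inl (by simp)
      · exact absurd rfl hbc))
    refine ⟨B, hB, (Set.toFinite ({1, t, t⁻¹, t * t} : Set G)).subset fun c hc => ?_⟩
    by_cases hc1 : c = 1
    · simp [hc1]
    by_cases hct : c = t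
    · simp [hct]
    have h₁ := (hdir B).1 hB.prop c hc 1 (htB (by simp)) hc1
    have h₂ := (hdir B).1 hB.prop c hc t (htB (by simp)) hct
    rw [inv_one, mul_one] at h₁
    rcases h₁ with rfl | rfl | ⟨x, hx, y, hy, hxy, rfl⟩
    · simp
    · simp
    rcases h₂ with h | h | ⟨x', hx', y', hy', hxy', h⟩
    · simp [mul_inv_eq_iff_eq_mul.1 h]
    · simp [mul_inv_eq_iff_eq_mul.1 h]
    -- If c and c * t⁻¹ are both nontrivial quotients of X, then t = (c * t⁻¹)⁻¹ * c is a product of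
    -- two such quotients.
    · refine absurd ?_ (hX y' hy' x' hx' x hx y hy hxy'.symm hxy)
      have : (x' * y'⁻¹)⁻¹ * (x * y⁻¹) = t := by rw [h]; group
      simpa using this

/-- Inversion reverses products, (ab)⁻¹ = b⁻¹a⁻¹, and so exchanges left and right subfactors. -/
theorem isDirect_inv_inv (A B : Set G) : IsDirect B⁻¹ A⁻¹ ↔ IsDirect A B := by
  have key : ∀ A B : Set G, IsDirect A B → IsDirect B⁻¹ A⁻¹ := by
    rintro A B h ⟨b, a⟩ ⟨hb, ha⟩ ⟨b', a'⟩ ⟨hb', ha'⟩ heq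
    have := @h (a⁻¹, b⁻¹) ⟨ha, hb⟩ (a'⁻¹, b'⁻¹) ⟨ha', hb'⟩
      (by simpa using congrArg (·⁻¹) heq)
    simp_all
  exact ⟨fun h => by simpa using key _ _ h, key A B⟩

theorem IsRightSubfactor.inv {A B : Set G} (h : IsRightSubfactor A B) :
    IsLeftSubfactor A⁻¹ B⁻¹ := by
  refine ⟨(isDirect_inv_inv A B).2 h.1, fun C hC hBC => ?_⟩
  have hC' : IsDirect A C⁻¹ := by rw [← isDirect_inv_inv, inv_inv]; exact hC
  have := h.2 hC' (by simpa using Set.inv_subset_inv.2 hBC)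
  simpa using Set.inv_subset_inv.2 this

theorem IsLeftSubfactor.inv {A B : Set G} (h : IsLeftSubfactor A B) :
    IsRightSubfactor A⁻¹ B⁻¹ := by
  refine ⟨(isDirect_inv_inv B A).2 h.1, fun C hC hBC => ?_⟩
  have hC' : IsDirect C⁻¹ A := by rw [← isDirect_inv_inv, inv_inv]; exact hC
  have := h.2 hC' (by simpa using Set.inv_subset_inv.2 hBC)
  simpa using Set.inv_subset_inv.2 this

theorem leftSubfactorCards_inv (A : Set G) :
    leftSubfactorCards A⁻¹ = rightSubfactorCards A := by
  ext c
  constructor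
  · rintro ⟨B, hB, rfl⟩
    exact ⟨B⁻¹, by simpa using hB.inv, Cardinal.mk_inv B⟩
  · rintro ⟨B, hB, rfl⟩
    exact ⟨B⁻¹, hB.inv, Cardinal.mk_inv B⟩

theorem exists_rightLowerIndex_lt_rightUpperIndex (G : Type u) [Group G] [Infinite G] :
    ∃ A : Set G, rightLowerIndex A < rightUpperIndex A ∧ rightUpperIndex A = ℵ₀ := by
  obtain ⟨A, hc, ⟨B, hB, hBi⟩, C, hC, hCf⟩ := exists_finite_and_infinite_rightSubfactors G
  have hup : rightUpperIndex A = ℵ₀ := by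
    refine le_antisymm (csSup_le (rightSubfactorCards_nonempty A) ?_) ?_
    · rintro c ⟨D, hD, rfl⟩
      exact Cardinal.le_aleph0_iff_set_countable.2 (hc D hD)
    · exact (Cardinal.infinite_iff.1 hBi.to_subtype).trans
        (le_csSup (bddAbove_rightSubfactorCards A) ⟨B, hB, rfl⟩)
  refine ⟨A, ?_, hup⟩
  rw [hup]
  exact (csInf_le' (show #C ∈ rightSubfactorCards A from ⟨C, hC, rfl⟩)).trans_lt
    (Cardinal.lt_aleph0_iff_set_finite.2 hCf)

theorem exists_leftLowerIndex_lt_leftUpperIndex (G : Type u) [Group G] [Infinite G] :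
    ∃ A : Set G, leftLowerIndex A < leftUpperIndex A ∧ leftUpperIndex A = ℵ₀ := by
  obtain ⟨A, h⟩ := exists_rightLowerIndex_lt_rightUpperIndex G
  refine ⟨A⁻¹, ?_⟩
  rwa [leftLowerIndex, leftUpperIndex, leftSubfactorCards_inv]

end Subfactors

end GroupSubset

theorem mainTheorem1 (G : Type u) [Group G] [Infinite G] :
    (∃ A : Set G, GroupSubset.leftLowerIndex A < GroupSubset.leftUpperIndex A ∧
      GroupSubset.leftUpperIndex A = Cardinal.aleph0) ∧
    (∃ A : Set G, GroupSubset.rightLowerIndex A < GroupSubset.rightUpperIndex A ∧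
      GroupSubset.rightUpperIndex A = Cardinal.aleph0) ∧
    ¬ IsLeftIndexStableGroup G ∧
    ¬ IsRightIndexStableGroup G ∧
    ¬ IsIndexStableGroup G ∧
    ¬ (∀ A B B' : Set G, GroupSubset.IsRightSubfactor A B → GroupSubset.IsRightSubfactor A B' →
      Cardinal.mk B = Cardinal.mk B') := by
  have hl := GroupSubset.exists_leftLowerIndex_lt_leftUpperIndex G
  have hr := GroupSubset.exists_rightLowerIndex_lt_rightUpperIndex G
  refine ⟨hl, hr, ?_, ?_, ?_, ?_⟩
  · obtain ⟨A, hA, -⟩ := hl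
    exact fun h => hA.ne' (h A)
  · obtain ⟨A, hA, -⟩ := hr
    exact fun h => hA.ne' (h A)
  · obtain ⟨A, hA, -⟩ := hr
    exact fun h => hA.ne' (h A).1
  · obtain ⟨A, -, ⟨B, hB, hBi⟩, C, hC, hCf⟩ :=
      GroupSubset.exists_finite_and_infinite_rightSubfactors G
    intro h
    have hlt : Cardinal.mk C < Cardinal.mk B :=
      (Cardinal.lt_aleph0_iff_set_finite.2 hCf).trans_le
        (Cardinal.infinite_iff.1 hBi.to_subtype)
    exact hlt.ne (h A C B hC hB)
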